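/- A \emph{basic lattice} is a set $B$ with an element $0$ and a transitive relation $\prec$ with $0\prec x$ for all $x\in B$, such that the relation $x\preceq y:\Leftrightarrow\forall z\,(z\prec x\Rightarrow z\prec y)$ is a (antisymmetric) lattice order, with meet $\wedge$ and join $\vee$, and such that the following hold for all $x,x',y,y',z\in B$, where $x\perp y$ means that no $z\neq 0$ satisfies $z\prec x$ and $z\prec y$: \begin{itemize} \item (Coinitiality) if $x\neq 0$ then there is $z\neq 0$ with $z\prec x$; \item (Cofinality) there is $y$ with $x\prec y$; \item (Interpolation) if $x\prec y$ then $x\prec z\prec y$ for some $z$; \item (Multiplicativity) if $x\prec x'$ and $y\prec y'$ then $x\wedge y\prec x'\wedge y'$; \item (Additivity) if $x\prec x'$ and $y\prec y'$ then $x\vee y\prec x'\vee y'$; \item (Decomposition) if $z\prec x\vee y$ then there are $x'\prec x$ and $y'\prec y$ with $z=x'\vee y'$; \item (Complementation) if $x\prec y\prec z$ then there is $w\perp x$ with $w\vee y=z$. \end{itemize} An \emph{interpolator} from a basic lattice $(B,\prec)$ to a basic lattice $(C,<)$ is a relation ${\sqsubset}\subseteq B\times C$ such that \begin{itemize} \item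 (Minimum) $0\sqsubset y$ for all $y\in C$, and $x\sqsubset 0$ only for $x=0$; \item (Cofinality) for every $x\in B$ there is $y\in C$ with $x\sqsubset y$; \item (Interpolation) if $x\sqsubset y$ then $x\sqsubset z<y$ for some $z\in C$, and $x\prec z'\sqsubset y$ for some $z'\in B$; \item (Multiplicativity) if $x\sqsubset x'$ and $y\sqsubset y'$ then $x\wedge y\sqsubset x'\wedge y'$; \item (Additivity) if $x\sqsubset x'$ and $y\sqsubset y'$ then $x\vee y\sqsubset x'\vee y'$; \item (Decomposition) if $z\sqsubset x\vee y$ then there are $x'\sqsubset x$ and $y'\sqsubset y$ with $z=x'\vee y'$. \end{itemize} Basic lattices and interpolators form a category $\mathbf{BasLat}$, in which the composite of ${\sqsubset}\subseteq B\times C$ and ${\sqsubset'}\subseteq C\times D$ is the relation $\{(x,z):\exists y\in C\ (x\sqsubset y\sqsubset' z)\}$ and the identity of $(B,\prec)$ is $\prec$. Let $\mathbf{LocHaus}$ be the category of locally compact Hausdorff spaces and continuous maps. \textbf{Theorem.} The categories $\mathbf{BasLat}$ and $\mathbf{LocHaus}$ are equivalent. -/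

import Mathlib

open CategoryTheory

universe u

/-- `x ⪯ y`, the reflexivization of a relation `r`: everything `r`-below `x` is `r`-below `y`. -/
def RelReflexivization {B : Type u} (r : B → B → Prop) (x y : B) : Prop :=
  ∀ z, r z x → r z y

/-- `x ⋒ y` for the relation `r` and the minimum `o`:
some element other than `o` is `r`-below both `x` and `y`. -/
def RelIntersects {B : Type u} (r : B → B → Prop) (o : B) (x y : B) : Prop :=
  ∃ z, z ≠ o ∧ r z x ∧ r z y

/-- `x ⟂ y` for the relation `r` and the minimum `o`:
no element other than `o` is `r`-below both `x` and `y`. -/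
def RelDisjoint {B : Type u} (r : B → B → Prop) (o : B) (x y : B) : Prop :=
  ¬ ∃ z, z ≠ o ∧ r z x ∧ r z y

/-- A basic lattice: a set with a transitive relation `prec` with minimum `⊥`, such that the
relation `⪯` defined from `prec` is a lattice order and the axioms below hold.
The order, the lattice operations and `⊥` are uniquely determined by `prec`
(by `le_iff` and antisymmetry); they are carried only so that `≤`, `⊓`, `⊔`, `⊥` can be written. -/
class BasicLattice (B : Type u) extends Lattice B, OrderBot B where
  /-- The primitive relation of the basic lattice. -/
  prec : B → B → Prop
  minimum : ∀ x, prec ⊥ x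
  transitivity : ∀ {x y z}, prec x y → prec y z → prec x z
  le_iff : ∀ x y, x ≤ y ↔ RelReflexivization prec x y
  coinitiality : ∀ x, x ≠ ⊥ → RelIntersects prec ⊥ x x
  cofinality : ∀ x, ∃ y, prec x y
  interpolation : ∀ {x y}, prec x y → ∃ z, prec x z ∧ prec z y
  multiplicativity : ∀ {x x' y y'}, prec x x' → prec y y' → prec (x ⊓ y) (x' ⊓ y')
  additivity : ∀ {x x' y y'}, prec x x' → prec y y' → prec (x ⊔ y) (x' ⊔ y')
  decomposition : ∀ {x y z}, prec z (x ⊔ y) → ∃ x' y', prec x' x ∧ prec y' y ∧ z = x' ⊔ y'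
  complementation : ∀ {x y z}, prec x y → prec y z → ∃ w, RelDisjoint prec ⊥ w x ∧ w ⊔ y = z

/-- An interpolator between basic lattices. The last field is decomposition for the empty join. -/
structure IsInterpolator {B C : Type u} [BasicLattice B] [BasicLattice C]
    (r : B → C → Prop) : Prop where
  minimum : ∀ y, r ⊥ y
  cofinality : ∀ x, ∃ y, r x y
  interpolation_right : ∀ {x y}, r x y → ∃ z, r x z ∧ BasicLattice.prec z y
  interpolation_left : ∀ {x y}, r x y → ∃ z, BasicLattice.prec x z ∧ r z y
  multiplicativity : ∀ {x x' y y'}, r x x' → r y y' → r (x ⊓ y) (x' ⊓ y')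
  additivity : ∀ {x x' y y'}, r x x' → r y y' → r (x ⊔ y) (x' ⊔ y')
  decomposition : ∀ {z x y}, r z (x ⊔ y) → ∃ x' y', r x' x ∧ r y' y ∧ z = x' ⊔ y'
  eq_bot : ∀ {x}, r x ⊥ → x = ⊥

theorem BasicLattice.le_of_prec {B : Type u} [BasicLattice B] {x y : B} (h : prec x y) : x ≤ y :=
  (le_iff x y).2 fun _ hz => transitivity hz h

namespace IsInterpolator

variable {B C D : Type u} [BasicLattice B] [BasicLattice C] [BasicLattice D]

theorem mono_right {r : B → C → Prop} (h : IsInterpolator r) {x : B} {y z : C}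
    (hxz : r x z) (hzy : z ≤ y) : r x y := by
  simpa [sup_eq_left.2 hzy] using h.additivity (h.minimum y) hxz

theorem mono_left {r : B → C → Prop} (h : IsInterpolator r) {x z : B} {y : C}
    (hxz : x ≤ z) (hzy : r z y) : r x y := by
  obtain ⟨w, hw⟩ := h.cofinality x
  have := h.multiplicativity hw hzy
  rw [inf_eq_left.2 hxz] at this
  exact h.mono_right this inf_le_right

/-- The relation of a basic lattice is an interpolator from the basic lattice to itself. -/
theorem prec (B : Type u) [BasicLattice B] :
    IsInterpolator (BasicLattice.prec : B → B → Prop) where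
  minimum := BasicLattice.minimum
  cofinality := BasicLattice.cofinality
  interpolation_right := BasicLattice.interpolation
  interpolation_left := BasicLattice.interpolation
  multiplicativity := BasicLattice.multiplicativity
  additivity := BasicLattice.additivity
  decomposition := BasicLattice.decomposition
  eq_bot h := le_bot_iff.1 (BasicLattice.le_of_prec h)

/-- Interpolators are closed under composition of relations. -/
theorem comp {r : B → C → Prop} {s : C → D → Prop} (hr : IsInterpolator r)
    (hs : IsInterpolator s) : IsInterpolator (Relation.Comp r s) where
  minimum y := ⟨⊥, hr.minimum ⊥, hs.minimum y⟩
  cofinality x := by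
    obtain ⟨y, hy⟩ := hr.cofinality x
    obtain ⟨z, hz⟩ := hs.cofinality y
    exact ⟨z, y, hy, hz⟩
  interpolation_right := by
    rintro x y ⟨c, h1, h2⟩
    obtain ⟨z, hz, hzy⟩ := hs.interpolation_right h2
    exact ⟨z, ⟨c, h1, hz⟩, hzy⟩
  interpolation_left := by
    rintro x y ⟨c, h1, h2⟩
    obtain ⟨z, hz, hzy⟩ := hr.interpolation_left h1
    exact ⟨z, hz, c, hzy, h2⟩
  multiplicativity := by
    rintro x x' y y' ⟨c, h1, h2⟩ ⟨d, h3, h4⟩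
    exact ⟨c ⊓ d, hr.multiplicativity h1 h3, hs.multiplicativity h2 h4⟩
  additivity := by
    rintro x x' y y' ⟨c, h1, h2⟩ ⟨d, h3, h4⟩
    exact ⟨c ⊔ d, hr.additivity h1 h3, hs.additivity h2 h4⟩
  decomposition := by
    rintro z x y ⟨c, h1, h2⟩
    obtain ⟨a, b, ha, hb, rfl⟩ := hs.decomposition h2
    obtain ⟨x', y', hx, hy, rfl⟩ := hr.decomposition h1
    exact ⟨x', y', ⟨a, hx, ha⟩, ⟨b, hy, hb⟩, rfl⟩
  eq_bot := by
    rintro x ⟨c, h1, h2⟩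
    rw [hs.eq_bot h2] at h1
    exact hr.eq_bot h1

theorem prec_comp {r : B → C → Prop} (h : IsInterpolator r) :
    Relation.Comp BasicLattice.prec r = r := by
  ext x y
  constructor
  · rintro ⟨z, h1, h2⟩
    exact h.mono_left (BasicLattice.le_of_prec h1) h2
  · exact h.interpolation_left

theorem comp_prec {r : B → C → Prop} (h : IsInterpolator r) :
    Relation.Comp r BasicLattice.prec = r := by
  ext x y
  constructor
  · rintro ⟨z, h1, h2⟩
    exact h.mono_right h1 (BasicLattice.le_of_prec h2)
  · exact h.interpolation_right

end IsInterpolator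

/-- The objects of the category of basic lattices. -/
structure BasLat : Type (u + 1) where
  carrier : Type u
  [str : BasicLattice carrier]

attribute [instance] BasLat.str

/-- Morphisms of basic lattices: interpolators. -/
@[ext]
structure BasLat.Hom (B C : BasLat.{u}) : Type u where
  rel : B.carrier → C.carrier → Prop
  isInterpolator : IsInterpolator rel

/-- The category of basic lattices and interpolators: the composition is the composition of
relations and the identity of `B` is its relation `prec`. -/
instance BasLat.category : Category.{u} BasLat.{u} where
  Hom := BasLat.Hom
  id B := ⟨BasicLattice.prec, IsInterpolator.prec B.carrier⟩
  comp f g := ⟨Relation.Comp f.rel g.rel, f.isInterpolator.comp g.isInterpolator⟩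
  id_comp f := BasLat.Hom.ext f.isInterpolator.prec_comp
  comp_id f := BasLat.Hom.ext f.isInterpolator.comp_prec
  assoc _ _ _ := BasLat.Hom.ext Relation.comp_assoc

/-- The category of locally compact Hausdorff spaces and continuous maps,
as a full subcategory of the category of topological spaces. -/
abbrev LocHaus : Type (u + 1) :=
  ObjectProperty.FullSubcategory
    (fun X : TopCat.{u} => T2Space X ∧ LocallyCompactSpace X)

/-!
A locally compact Hausdorff space `X` is sent to the lattice `RelCompactOpens X` of its open sets
with compact closure, where `U ≺ V` means `closure U ⊆ V`, and a continuous map `f : X → Y` to the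
interpolator relating `U` to `V` when `closure U ⊆ f ⁻¹' V`. This functor is shown to be fully
faithful and essentially surjective.

*Points.* The points of a basic lattice `B` are its round prime filters, and the sets `basicOpen x`
of all points containing `x` form a base of a topology. Decomposition makes `B` distributive, so the
prime ideal theorem applies; decomposition again shows that the round part of a prime filter is a
point. Hence there are enough points (`RoundPrimeFilter.mem_of_basicOpen_subset`): if `x ≺ y` and
the sets `basicOpen z`, for `z` in an ideal `I`, cover `basicOpen y`, then `x ∈ I`. It follows
that a closed subset of `basicOpen x` is compact. Complementation gives that the spectrum is
Hausdorff and that `closure (basicOpen x) ⊆ basicOpen y` when `x ≺ y`; so the closure of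
`basicOpen x` is compact, the spectrum is locally compact, and a compactness argument shows that
`closure (basicOpen x) ⊆ basicOpen y` implies `x ≺ y`.

*Essential surjectivity.* The sets `basicOpen x` form a base closed under finite unions, so that
whenever `K ⊆ U` with `K` compact and `U` open, some `basicOpen x` with closure in `U` contains `K`.
By this interpolation property the relations `closure (basicOpen x) ⊆ U` and
`closure U ⊆ basicOpen x` are mutually inverse interpolators between `B` and the relatively compact
open sets of its spectrum. They identify `B` with a base of the topology only, which is why
the isomorphism is one of interpolators and not of lattices.

*Fullness.* In a locally compact Hausdorff space `Y` every round prime filter of relatively compact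
open sets consists of those containing a given point (`RelCompactOpens.exists_forall_mem_iff`). An
interpolator `r` sends a point `x` of `X` to the filter of all `V` with `r U V` for some `U`
containing `x`, which defines a map `f : X → Y`; a compactness argument shows that `r` is the
interpolator of `f`.
-/

/-! ### Arithmetic of basic lattices -/

local infix:50 " ≺ " => BasicLattice.prec

namespace BasicLattice

variable {B : Type u} [BasicLattice B] {x y z w : B}

theorem prec_of_le_of_prec (h : x ≤ y) (hy : y ≺ z) : x ≺ z :=
  (IsInterpolator.prec B).mono_left h hy

theorem prec_of_prec_of_le (h : x ≺ y) (hy : y ≤ z) : x ≺ z :=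
  (le_iff y z).1 hy x h

theorem le_of_forall_prec_le (h : ∀ z, z ≺ x → z ≤ y) : x ≤ y := by
  refine (le_iff x y).2 fun z hz => ?_
  obtain ⟨t, hzt, htx⟩ := interpolation hz
  exact prec_of_prec_of_le hzt (h t htx)

theorem relDisjoint_iff : RelDisjoint prec ⊥ x y ↔ x ⊓ y = ⊥ := by
  constructor
  · intro h
    by_contra hne
    obtain ⟨z, hz, hzxy, -⟩ := coinitiality _ hne
    exact h ⟨z, hz, prec_of_prec_of_le hzxy inf_le_left, prec_of_prec_of_le hzxy inf_le_right⟩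
  · rintro h ⟨z, hz, hx, hy⟩
    exact hz (le_bot_iff.1 (h ▸ le_inf (le_of_prec hx) (le_of_prec hy)))

/-- Distributivity is a consequence of decomposition, applied to the elements `≺`-below
`x ⊓ (y ⊔ z)`. -/
theorem inf_sup_le (x y z : B) : x ⊓ (y ⊔ z) ≤ x ⊓ y ⊔ x ⊓ z := by
  refine le_of_forall_prec_le fun t ht => ?_
  obtain ⟨y', z', hy, hz, rfl⟩ := decomposition (prec_of_prec_of_le ht inf_le_right)
  have hx := le_of_prec (prec_of_prec_of_le ht inf_le_left)
  exact sup_le_sup (le_inf (le_sup_left.trans hx) (le_of_prec hy))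
    (le_inf (le_sup_right.trans hx) (le_of_prec hz))

instance (priority := low) toDistribLattice : DistribLattice B :=
  DistribLattice.ofInfSupLe inf_sup_le

/-- Complementation without an upper bound: if `x ≺ y`, any `z` can be covered by `y` and an
element disjoint from `x`. -/
theorem exists_inf_eq_bot_le_sup (h : x ≺ y) (z : B) : ∃ w, w ⊓ x = ⊥ ∧ z ≤ w ⊔ y := by
  obtain ⟨t, ht⟩ := cofinality (y ⊔ z)
  obtain ⟨w, hw, hwt⟩ := complementation h (prec_of_le_of_prec le_sup_left ht)
  exact ⟨w, relDisjoint_iff.1 hw, hwt ▸ le_sup_right.trans (le_of_prec ht)⟩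

end BasicLattice

open BasicLattice

/-! ### The spectrum of a basic lattice -/

/-- A point of the spectrum of a basic lattice: a proper prime filter which is round, in that each
of its elements is `≻`-above another one. -/
@[ext]
structure RoundPrimeFilter (B : Type u) [BasicLattice B] : Type u where
  carrier : Set B
  nonempty : carrier.Nonempty
  mem_of_le : ∀ {x y}, x ∈ carrier → x ≤ y → y ∈ carrier
  inf_mem : ∀ {x y}, x ∈ carrier → y ∈ carrier → x ⊓ y ∈ carrier
  bot_notMem : ⊥ ∉ carrier
  mem_or_mem : ∀ {x y}, x ⊔ y ∈ carrier → x ∈ carrier ∨ y ∈ carrier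
  exists_prec : ∀ {x}, x ∈ carrier → ∃ y ∈ carrier, y ≺ x

namespace RoundPrimeFilter

variable {B : Type u} [BasicLattice B] {x y z : B}

/-- The basic open set of all points containing `x`. -/
def basicOpen (x : B) : Set (RoundPrimeFilter B) := {p | x ∈ p.carrier}

@[simp]
theorem mem_basicOpen {p : RoundPrimeFilter B} : p ∈ basicOpen x ↔ x ∈ p.carrier := Iff.rfl

theorem basicOpen_mono (h : x ≤ y) : basicOpen x ⊆ basicOpen y :=
  fun p hp => p.mem_of_le hp h

theorem basicOpen_sup (x y : B) : basicOpen (x ⊔ y) = basicOpen x ∪ basicOpen y :=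
  Set.Subset.antisymm (fun p hp => p.mem_or_mem hp)
    (Set.union_subset (basicOpen_mono le_sup_left) (basicOpen_mono le_sup_right))

theorem basicOpen_inf (x y : B) : basicOpen (x ⊓ y) = basicOpen x ∩ basicOpen y :=
  Set.Subset.antisymm
    (Set.subset_inter (basicOpen_mono inf_le_left) (basicOpen_mono inf_le_right))
    (fun p hp => p.inf_mem hp.1 hp.2)

@[simp]
theorem basicOpen_bot : basicOpen (⊥ : B) = ∅ :=
  Set.eq_empty_of_forall_notMem fun p => p.bot_notMem

/-- The topology of the spectrum, with the sets `basicOpen x` as a base. -/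
instance : TopologicalSpace (RoundPrimeFilter B) where
  IsOpen U := ∀ p ∈ U, ∃ x, p ∈ basicOpen x ∧ basicOpen x ⊆ U
  isOpen_univ p _ := p.nonempty.imp fun _ hx => ⟨hx, Set.subset_univ _⟩
  isOpen_inter U V hU hV p hp := by
    obtain ⟨x, hx, hxU⟩ := hU p hp.1
    obtain ⟨y, hy, hyV⟩ := hV p hp.2
    exact ⟨x ⊓ y, p.inf_mem hx hy, basicOpen_inf x y ▸ Set.inter_subset_inter hxU hyV⟩
  isOpen_sUnion S hS p := by
    rintro ⟨U, hU, hp⟩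
    obtain ⟨x, hx, hxU⟩ := hS U hU p hp
    exact ⟨x, hx, Set.subset_sUnion_of_subset S U hxU hU⟩

theorem isOpen_iff {U : Set (RoundPrimeFilter B)} :
    IsOpen U ↔ ∀ p ∈ U, ∃ x, p ∈ basicOpen x ∧ basicOpen x ⊆ U := Iff.rfl

theorem isOpen_basicOpen (x : B) : IsOpen (basicOpen x) :=
  fun _ hp => ⟨x, hp, subset_rfl⟩

/-- The round part of a prime filter, given as the complement of a prime ideal `J`. Primeness
survives by decomposition. -/
def ofPrimeIdeal (J : Order.Ideal B) (hJ : J.IsPrime) (hne : ∃ x y, x ∉ J ∧ x ≺ y) :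
    RoundPrimeFilter B where
  carrier := {y | ∃ x, x ∉ J ∧ x ≺ y}
  nonempty := let ⟨x, y, h⟩ := hne; ⟨y, x, h⟩
  mem_of_le := fun ⟨z, hz, h⟩ hxy => ⟨z, hz, prec_of_prec_of_le h hxy⟩
  inf_mem := fun ⟨z, hz, h⟩ ⟨w, hw, h'⟩ =>
    ⟨z ⊓ w, fun hzw => (hJ.mem_or_mem hzw).elim hz hw, multiplicativity h h'⟩
  bot_notMem := fun ⟨z, hz, h⟩ => hz (J.lower (le_of_prec h) J.bot_mem)
  mem_or_mem := by
    rintro x y ⟨z, hz, h⟩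
    obtain ⟨x', y', hx, hy, rfl⟩ := decomposition h
    by_contra! hxy
    refine hz (J.sup_mem ?_ ?_)
    · exact not_not.1 fun h' => hxy.1 ⟨x', h', hx⟩
    · exact not_not.1 fun h' => hxy.2 ⟨y', h', hy⟩
  exists_prec := by
    rintro x ⟨z, hz, h⟩
    obtain ⟨w, hzw, hwx⟩ := interpolation h
    exact ⟨w, ⟨z, hz, hzw⟩, hwx⟩

/-- There are enough points: this is the prime ideal theorem, from which all compactness in the
spectrum is derived. -/
theorem mem_of_basicOpen_subset (I : Order.Ideal B) (hxy : x ≺ y)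
    (h : ∀ p ∈ basicOpen y, ∃ z ∈ I, p ∈ basicOpen z) : x ∈ I := by
  by_contra hx
  have hd : Disjoint (Order.PFilter.principal x : Set B) (I : Set B) :=
    Set.disjoint_left.2 fun z hz hzI => hx (I.lower (Order.PFilter.mem_principal.1 hz) hzI)
  obtain ⟨J, hJ, hIJ, hd⟩ := DistribLattice.prime_ideal_of_disjoint_filter_ideal hd
  have hxJ : x ∉ J := Set.disjoint_left.1 hd (Order.PFilter.mem_principal.2 le_rfl)
  obtain ⟨z, hz, w, hw, hwz⟩ := h (ofPrimeIdeal J hJ ⟨x, y, hxJ, hxy⟩) ⟨x, hxJ, hxy⟩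
  exact hw (J.lower (le_of_prec hwz) (hIJ hz))

theorem le_iff_basicOpen_subset : x ≤ y ↔ basicOpen x ⊆ basicOpen y := by
  refine ⟨basicOpen_mono, fun h => le_of_forall_prec_le fun z hz => ?_⟩
  exact Order.Ideal.mem_principal.1
    (mem_of_basicOpen_subset (Order.Ideal.principal y) hz
      fun p hp => ⟨y, Order.Ideal.mem_principal.2 le_rfl, h hp⟩)

/-- If `x ≺ y`, a point omitting `y` contains an element disjoint from `x`. -/
theorem exists_mem_inf_eq_bot (p : RoundPrimeFilter B) (hxy : x ≺ y) (hy : y ∉ p.carrier) :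
    ∃ w ∈ p.carrier, w ⊓ x = ⊥ := by
  obtain ⟨z, hz⟩ := p.nonempty
  obtain ⟨w, hw, hzw⟩ := exists_inf_eq_bot_le_sup hxy z
  exact ⟨w, (p.mem_or_mem (p.mem_of_le hz hzw)).resolve_right hy, hw⟩

theorem disjoint_basicOpen (h : x ⊓ y = ⊥) : Disjoint (basicOpen x) (basicOpen y) := by
  rw [Set.disjoint_iff_inter_eq_empty, ← basicOpen_inf, h, basicOpen_bot]

instance : T2Space (RoundPrimeFilter B) := by
  have key : ∀ p q : RoundPrimeFilter B, ∀ x ∈ p.carrier, x ∉ q.carrier →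
      ∃ u v : Set (RoundPrimeFilter B), IsOpen u ∧ IsOpen v ∧ p ∈ u ∧ q ∈ v ∧ Disjoint u v := by
    intro p q x hx hxq
    obtain ⟨y, hy, hyx⟩ := p.exists_prec hx
    obtain ⟨w, hw, hwy⟩ := q.exists_mem_inf_eq_bot hyx hxq
    exact ⟨basicOpen y, basicOpen w, isOpen_basicOpen y, isOpen_basicOpen w, hy, hw,
      (disjoint_basicOpen hwy).symm⟩
  refine ⟨fun p q hpq => ?_⟩
  have : ¬ ∀ x, x ∈ p.carrier ↔ x ∈ q.carrier := fun h => hpq (RoundPrimeFilter.ext (Set.ext h))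
  push Not at this
  obtain ⟨x, ⟨hp, hq⟩ | ⟨hp, hq⟩⟩ := this
  · exact key p q x hp hq
  · obtain ⟨u, v, hu, hv, hqu, hpv, huv⟩ := key q p x hq hp
    exact ⟨v, u, hv, hu, hpv, hqu, huv.symm⟩

theorem closure_basicOpen_subset (h : x ≺ y) : closure (basicOpen x) ⊆ basicOpen y := by
  intro p hp
  by_contra hy
  obtain ⟨w, hw, hwx⟩ := p.exists_mem_inf_eq_bot h hy
  obtain ⟨q, hqw, hqx⟩ := mem_closure_iff.1 hp _ (isOpen_basicOpen w) hw
  exact Set.disjoint_left.1 (disjoint_basicOpen hwx) hqw hqx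

theorem isCompact_of_subset_basicOpen {K : Set (RoundPrimeFilter B)} (hK : IsClosed K)
    (h : x ≺ y) (hKx : K ⊆ basicOpen x) : IsCompact K := by
  refine isCompact_of_finite_subcover fun {ι} U hU hKU => ?_
  classical
  -- The elements whose part in `K` is covered by finitely many `U i` form an ideal.
  let I : Order.Ideal B :=
    { carrier := {z | ∃ t : Finset ι, basicOpen z ∩ K ⊆ ⋃ i ∈ t, U i}
      lower' := fun z w hwz ⟨t, ht⟩ =>
        ⟨t, (Set.inter_subset_inter_left _ (basicOpen_mono hwz)).trans ht⟩
      nonempty' := ⟨⊥, ∅, by simp⟩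
      directed' := by
        rintro z ⟨s, hs⟩ w ⟨t, ht⟩
        refine ⟨z ⊔ w, ⟨s ∪ t, ?_⟩, le_sup_left, le_sup_right⟩
        rw [basicOpen_sup, Set.union_inter_distrib_right, Finset.set_biUnion_union]
        exact Set.union_subset_union hs ht }
  obtain ⟨t, ht⟩ : x ∈ I := by
    refine mem_of_basicOpen_subset I h fun p _ => ?_
    by_cases hp : p ∈ K
    · obtain ⟨i, hi⟩ := Set.mem_iUnion.1 (hKU hp)
      obtain ⟨z, hpz, hz⟩ := isOpen_iff.1 (hU i) p hi
      exact ⟨z, ⟨{i}, by simpa using Set.inter_subset_left.trans hz⟩, hpz⟩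
    · obtain ⟨z, hpz, hz⟩ := isOpen_iff.1 hK.isOpen_compl p hp
      refine ⟨z, ⟨∅, fun q hq => (hz hq.1 hq.2).elim⟩, hpz⟩
  exact ⟨t, fun p hp => ht ⟨hKx hp, hp⟩⟩

theorem isCompact_closure_basicOpen (x : B) : IsCompact (closure (basicOpen x)) := by
  obtain ⟨y, hy⟩ := cofinality x
  obtain ⟨z, hxz, hzy⟩ := interpolation hy
  exact isCompact_of_subset_basicOpen isClosed_closure hzy (closure_basicOpen_subset hxz)

instance : LocallyCompactSpace (RoundPrimeFilter B) :=
  have : WeaklyLocallyCompactSpace (RoundPrimeFilter B) := ⟨fun p => by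
    obtain ⟨x, hx⟩ := p.nonempty
    exact ⟨closure (basicOpen x), isCompact_closure_basicOpen x,
      Filter.mem_of_superset ((isOpen_basicOpen x).mem_nhds hx) subset_closure⟩⟩
  inferInstance

/-- A compact subset of an open set is contained in a basic open set with closure in the open set,
since the basic open sets form a base closed under finite unions. -/
theorem exists_basicOpen_between {K U : Set (RoundPrimeFilter B)} (hK : IsCompact K)
    (hU : IsOpen U) (hKU : K ⊆ U) : ∃ x : B, K ⊆ basicOpen x ∧ closure (basicOpen x) ⊆ U := by
  refine hK.induction_on (p := fun K => ∃ x : B, K ⊆ basicOpen x ∧ closure (basicOpen x) ⊆ U)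
    ⟨⊥, by simp⟩ (fun s t hst ⟨x, hx, hxU⟩ => ⟨x, hst.trans hx, hxU⟩) ?_ ?_
  · rintro s t ⟨x, hx, hxU⟩ ⟨y, hy, hyU⟩
    refine ⟨x ⊔ y, ?_, ?_⟩
    · rw [basicOpen_sup]
      exact Set.union_subset_union hx hy
    · rw [basicOpen_sup, closure_union]
      exact Set.union_subset hxU hyU
  · intro p hp
    obtain ⟨x, hx, hxU⟩ := isOpen_iff.1 hU p (hKU hp)
    obtain ⟨y, hy, hyx⟩ := p.exists_prec hx
    exact ⟨basicOpen y, mem_nhdsWithin_of_mem_nhds ((isOpen_basicOpen y).mem_nhds hy),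
      y, subset_rfl, (closure_basicOpen_subset hyx).trans hxU⟩

/-- The relation of a basic lattice is recovered from the topology of its spectrum. -/
theorem prec_iff_closure_subset : x ≺ y ↔ closure (basicOpen x) ⊆ basicOpen y := by
  refine ⟨closure_basicOpen_subset, fun h => ?_⟩
  -- By roundness `basicOpen y` is the directed union of the `basicOpen z` with `z ≺ y`.
  obtain ⟨z, hzy, hxz⟩ : ∃ z, z ≺ y ∧ closure (basicOpen x) ⊆ basicOpen z := by
    refine (isCompact_closure_basicOpen x).induction_on
      (p := fun K => ∃ z, z ≺ y ∧ K ⊆ basicOpen z) ⟨⊥, minimum y, Set.empty_subset _⟩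
      (fun s t hst ⟨z, hz, htz⟩ => ⟨z, hz, hst.trans htz⟩) ?_ ?_
    · rintro s t ⟨z, hz, hsz⟩ ⟨w, hw, htw⟩
      exact ⟨z ⊔ w, sup_idem y ▸ additivity hz hw,
        basicOpen_sup z w ▸ Set.union_subset_union hsz htw⟩
    · intro p hp
      obtain ⟨z, hz, hzy⟩ := p.exists_prec (h hp)
      exact ⟨basicOpen z, mem_nhdsWithin_of_mem_nhds ((isOpen_basicOpen z).mem_nhds hz),
        z, hzy, subset_rfl⟩
  exact prec_of_le_of_prec (le_iff_basicOpen_subset.2 (subset_closure.trans hxz)) hzy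

end RoundPrimeFilter

/-! ### Relatively compact open sets -/

/-- The open sets with compact closure. -/
def RelCompactOpens (X : Type u) [TopologicalSpace X] : Type u :=
  {U : TopologicalSpace.Opens X // IsCompact (closure (U : Set X))}

namespace RelCompactOpens

section

variable {X : Type u} [TopologicalSpace X]

instance : SetLike (RelCompactOpens X) X where
  coe U := (U.1 : Set X)
  coe_injective _ _ h := Subtype.ext (SetLike.coe_injective h)

theorem isOpen (U : RelCompactOpens X) : IsOpen (U : Set X) := U.1.isOpen

theorem isCompact_closure (U : RelCompactOpens X) : IsCompact (closure (U : Set X)) := U.2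

/-- An open set with compact closure, bundled. -/
def mk (U : Set X) (hU : IsOpen U) (hc : IsCompact (closure U)) : RelCompactOpens X :=
  ⟨⟨U, hU⟩, hc⟩

/-- An open subset of a relatively compact open set, bundled. -/
def ofSubset (U : RelCompactOpens X) (V : Set X) (hV : IsOpen V) (h : V ⊆ U) :
    RelCompactOpens X :=
  mk V hV (U.isCompact_closure.of_isClosed_subset isClosed_closure (closure_mono h))

instance : Lattice (RelCompactOpens X) :=
  Subtype.lattice
    (fun U V hU hV => by
      rw [TopologicalSpace.Opens.coe_sup, closure_union]
      exact hU.union hV)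
    (fun U V hU _ => hU.of_isClosed_subset isClosed_closure (closure_mono Set.inter_subset_left))

instance : OrderBot (RelCompactOpens X) :=
  Subtype.orderBot (by simp)

theorem le_def {U V : RelCompactOpens X} : U ≤ V ↔ (U : Set X) ⊆ V := Iff.rfl

@[simp]
theorem coe_sup (U V : RelCompactOpens X) : ((U ⊔ V : RelCompactOpens X) : Set X) = (U : Set X) ∪ V :=
  rfl

@[simp]
theorem coe_inf (U V : RelCompactOpens X) : ((U ⊓ V : RelCompactOpens X) : Set X) = (U : Set X) ∩ V :=
  rfl

@[simp]
theorem coe_bot : ((⊥ : RelCompactOpens X) : Set X) = ∅ := rfl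

end

variable {X : Type u} [TopologicalSpace X] [T2Space X] [LocallyCompactSpace X]

theorem exists_between {K U : Set X} (hK : IsCompact K) (hU : IsOpen U) (hKU : K ⊆ U) :
    ∃ V : RelCompactOpens X, K ⊆ V ∧ closure (V : Set X) ⊆ U := by
  obtain ⟨V, hV, hKV, hVU, hc⟩ := exists_open_between_and_isCompact_closure hK hU hKU
  exact ⟨mk V hV hc, hKV, hVU⟩

theorem exists_mem_between {x : X} {U : Set X} (hU : IsOpen U) (hx : x ∈ U) :
    ∃ V : RelCompactOpens X, x ∈ V ∧ closure (V : Set X) ⊆ U := by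
  simpa using exists_between (isCompact_singleton (x := x)) hU (by simpa using hx)

theorem exists_closure_subset (U : RelCompactOpens X) :
    ∃ V : RelCompactOpens X, closure (U : Set X) ⊆ V :=
  (exists_between U.isCompact_closure isOpen_univ (Set.subset_univ _)).imp fun _ h => h.1

/-- Decomposition for relatively compact open sets. -/
theorem exists_eq_sup_of_closure_subset_union (W : RelCompactOpens X) {U V : Set X}
    (hU : IsOpen U) (hV : IsOpen V) (h : closure (W : Set X) ⊆ U ∪ V) :
    ∃ U' V' : RelCompactOpens X,
      closure (U' : Set X) ⊆ U ∧ closure (V' : Set X) ⊆ V ∧ W = U' ⊔ V' := by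
  obtain ⟨K, L, hK, hL, hKU, hLV, hKL⟩ := W.isCompact_closure.binary_compact_cover hU hV h
  obtain ⟨U', hU', hUU⟩ := exists_between hK hU hKU
  obtain ⟨V', hV', hVV⟩ := exists_between hL hV hLV
  refine ⟨W ⊓ U', W ⊓ V', (closure_mono Set.inter_subset_right).trans hUU,
    (closure_mono Set.inter_subset_right).trans hVV, SetLike.coe_injective ?_⟩
  rw [coe_sup, coe_inf, coe_inf, ← Set.inter_union_distrib_left, eq_comm, Set.inter_eq_left]
  exact subset_closure.trans (hKL ▸ Set.union_subset_union hU' hV')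

/-- The relatively compact open sets of a locally compact Hausdorff space form a basic lattice,
where `U ≺ V` means that `V` contains the closure of `U`. -/
instance : BasicLattice (RelCompactOpens X) where
  prec U V := closure (U : Set X) ⊆ V
  minimum U := by simp
  transitivity hUV hVW := hUV.trans (subset_closure.trans hVW)
  le_iff U V := by
    refine ⟨fun h W hW => hW.trans h, fun h x hx => ?_⟩
    obtain ⟨W, hxW, hWU⟩ := exists_mem_between U.isOpen hx
    exact h W hWU (subset_closure hxW)
  coinitiality U hU := by
    have : (U : Set X).Nonempty := Set.nonempty_iff_ne_empty.2 fun h =>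
      hU (SetLike.coe_injective h)
    obtain ⟨x, hx⟩ := this
    obtain ⟨W, hxW, hWU⟩ := exists_mem_between U.isOpen hx
    refine ⟨W, ?_, hWU, hWU⟩
    rintro rfl
    exact hxW
  cofinality := exists_closure_subset
  interpolation {U V} h := exists_between U.isCompact_closure V.isOpen h
  multiplicativity {U U' V V'} h h' :=
    closure_inter_subset_inter_closure _ _ |>.trans (Set.inter_subset_inter h h')
  additivity {U U' V V'} h h' := by
    rw [coe_sup, coe_sup, closure_union]
    exact Set.union_subset_union h h'
  decomposition {U V W} h := exists_eq_sup_of_closure_subset_union W U.isOpen V.isOpen h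
  complementation {U V W} h h' := by
    refine ⟨W.ofSubset (W \ closure U) (W.isOpen.sdiff isClosed_closure) Set.sdiff_subset, ?_,
      SetLike.coe_injective ?_⟩
    · rintro ⟨Z, hZ, h1, h2⟩
      refine hZ (SetLike.coe_injective (Set.eq_empty_of_forall_notMem fun x hx => ?_))
      exact (h1 (subset_closure hx)).2 (subset_closure (h2 (subset_closure hx)))
    · refine Set.Subset.antisymm (Set.union_subset Set.sdiff_subset (subset_closure.trans h')) ?_
      intro x hx
      by_cases hxU : x ∈ closure (U : Set X)
      · exact Or.inr (h hxU)
      · exact Or.inl ⟨hx, hxU⟩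

theorem prec_iff {U V : RelCompactOpens X} : U ≺ V ↔ closure (U : Set X) ⊆ V := Iff.rfl

/-- Every round prime filter of relatively compact open sets consists of those containing
some point, which is obtained from compactness of the closures of its members. -/
theorem exists_forall_mem_iff (p : RoundPrimeFilter (RelCompactOpens X)) :
    ∃ x : X, ∀ U : RelCompactOpens X, U ∈ p.carrier ↔ x ∈ U := by
  obtain ⟨V, hV⟩ := p.nonempty
  have : Nonempty p.carrier := ⟨⟨V, hV⟩⟩
  obtain ⟨x, hx⟩ : (⋂ U : p.carrier, closure ((U : RelCompactOpens X) : Set X)).Nonempty := by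
    refine IsCompact.nonempty_iInter_of_directed_nonempty_isCompact_isClosed _ ?_ ?_
      (fun U => U.1.isCompact_closure) (fun U => isClosed_closure)
    · exact fun U W => ⟨⟨U.1 ⊓ W.1, p.inf_mem U.2 W.2⟩, closure_mono Set.inter_subset_left,
        closure_mono Set.inter_subset_right⟩
    · intro U
      refine Set.Nonempty.closure (Set.nonempty_iff_ne_empty.2 fun h => p.bot_notMem ?_)
      rw [← show U.1 = ⊥ from SetLike.coe_injective h]
      exact U.2
  have hmem : ∀ U ∈ p.carrier, x ∈ U := fun U hU => by
    obtain ⟨W, hW, hWU⟩ := p.exists_prec hU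
    exact hWU (Set.mem_iInter.1 hx ⟨W, hW⟩)
  refine ⟨x, fun U => ⟨hmem U, fun hxU => ?_⟩⟩
  by_contra hU
  obtain ⟨W, hxW, hWU⟩ := exists_mem_between U.isOpen hxU
  obtain ⟨Z, hZ, hZW⟩ := p.exists_mem_inf_eq_bot (prec_iff.2 hWU) hU
  have : x ∈ (Z ⊓ W : RelCompactOpens X) := ⟨hmem Z hZ, hxW⟩
  rw [hZW] at this
  exact this

end RelCompactOpens

/-! ### Continuous maps and interpolators -/

open RelCompactOpens

/-- The interpolator of a map `f`: the closure of `U` is mapped into `V`. -/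
def mapRel {X Y : Type u} [TopologicalSpace X] [TopologicalSpace Y] (f : X → Y)
    (U : RelCompactOpens X) (V : RelCompactOpens Y) : Prop :=
  closure (U : Set X) ⊆ f ⁻¹' V

theorem comp_mapRel {X Y Z : Type u} [TopologicalSpace X] [TopologicalSpace Y] [T2Space Y]
    [LocallyCompactSpace Y] [TopologicalSpace Z] {f : X → Y} {g : Y → Z} (hf : Continuous f)
    (hg : Continuous g) : Relation.Comp (mapRel f) (mapRel g) = mapRel (g ∘ f) := by
  ext U W
  constructor
  · rintro ⟨V, hUV, hVW⟩ x hx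
    exact hVW (subset_closure (hUV hx))
  · intro h
    obtain ⟨V, hV, hVW⟩ := RelCompactOpens.exists_between (U.isCompact_closure.image hf)
      (W.isOpen.preimage hg) (Set.image_subset_iff.2 h)
    exact ⟨V, Set.image_subset_iff.1 hV, hVW⟩

variable {X Y : Type u} [TopologicalSpace X] [T2Space X] [LocallyCompactSpace X]
  [TopologicalSpace Y] [T2Space Y] [LocallyCompactSpace Y]

theorem isInterpolator_mapRel {f : X → Y} (hf : Continuous f) : IsInterpolator (mapRel f) where
  minimum V := by simp [mapRel]
  cofinality U := by
    obtain ⟨V, hV, -⟩ := RelCompactOpens.exists_between (U.isCompact_closure.image hf) isOpen_univ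
      (Set.subset_univ _)
    exact ⟨V, Set.image_subset_iff.1 hV⟩
  interpolation_right {U V} h := by
    obtain ⟨W, hW, hWV⟩ := RelCompactOpens.exists_between (U.isCompact_closure.image hf) V.isOpen
      (Set.image_subset_iff.2 h)
    exact ⟨W, Set.image_subset_iff.1 hW, hWV⟩
  interpolation_left {U V} h :=
    RelCompactOpens.exists_between U.isCompact_closure (V.isOpen.preimage hf) h
  multiplicativity h h' :=
    closure_inter_subset_inter_closure _ _ |>.trans (Set.inter_subset_inter h h')
  additivity h h' := by
    rw [mapRel, coe_sup, coe_sup, closure_union]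
    exact Set.union_subset_union h h'
  decomposition {W U V} h :=
    exists_eq_sup_of_closure_subset_union W (U.isOpen.preimage hf) (V.isOpen.preimage hf) h
  eq_bot {U} h := SetLike.coe_injective (Set.subset_eq_empty (subset_closure.trans h) rfl)

theorem mapRel_injective {f g : X → Y} (hf : Continuous f) (h : mapRel f = mapRel g) : f = g := by
  ext x
  by_contra hne
  obtain ⟨V, hV, hVg⟩ := RelCompactOpens.exists_mem_between
    (isOpen_compl_singleton (x := g x)) (Set.mem_compl_singleton_iff.2 hne)
  obtain ⟨U, hU, hUV⟩ := RelCompactOpens.exists_mem_between (V.isOpen.preimage hf) hV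
  have : mapRel g U V := h ▸ hUV
  exact hVg (subset_closure (this (subset_closure hU))) rfl

namespace IsInterpolator

variable {r : RelCompactOpens X → RelCompactOpens Y → Prop}

/-- The round prime filter to which an interpolator sends a point `x`. It consists
of the relatively compact open sets containing the image of `x` under the corresponding map. -/
def filterAt (hr : IsInterpolator r) (x : X) : RoundPrimeFilter (RelCompactOpens Y) where
  carrier := {V | ∃ U, x ∈ U ∧ r U V}
  nonempty := by
    obtain ⟨U, hU, -⟩ := RelCompactOpens.exists_mem_between isOpen_univ (Set.mem_univ x)
    obtain ⟨V, hV⟩ := hr.cofinality U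
    exact ⟨V, U, hU, hV⟩
  mem_of_le := fun ⟨U, hU, h⟩ hVW => ⟨U, hU, hr.mono_right h hVW⟩
  inf_mem := fun ⟨U, hU, h⟩ ⟨U', hU', h'⟩ => ⟨U ⊓ U', ⟨hU, hU'⟩, hr.multiplicativity h h'⟩
  bot_notMem := by
    rintro ⟨U, hU, h⟩
    rw [hr.eq_bot h] at hU
    exact hU
  mem_or_mem := by
    rintro V W ⟨U, hU, h⟩
    obtain ⟨V', W', hV, hW, rfl⟩ := hr.decomposition h
    exact hU.imp (fun hU => ⟨V', hU, hV⟩) (fun hU => ⟨W', hU, hW⟩)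
  exists_prec := by
    rintro V ⟨U, hU, h⟩
    obtain ⟨W, hUW, hWV⟩ := hr.interpolation_right h
    exact ⟨W, ⟨U, hU, hUW⟩, hWV⟩

theorem exists_continuous_mapRel_eq (hr : IsInterpolator r) :
    ∃ f : X → Y, Continuous f ∧ mapRel f = r := by
  choose f hf using fun x => exists_forall_mem_iff (hr.filterAt x)
  replace hf : ∀ x V, (∃ U, x ∈ U ∧ r U V) ↔ f x ∈ V := hf
  refine ⟨f, continuous_iff_continuousAt.2 fun x => ?_, ?_⟩
  · intro N hN
    obtain ⟨O, hON, hO, hxO⟩ := mem_nhds_iff.1 hN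
    obtain ⟨V, hxV, hVO⟩ := RelCompactOpens.exists_mem_between hO hxO
    obtain ⟨U, hxU, hUV⟩ := (hf x V).2 hxV
    refine Filter.mem_map.2 <| Filter.mem_of_superset (U.isOpen.mem_nhds hxU) fun z hz => ?_
    exact hON (hVO (subset_closure ((hf z V).1 ⟨U, hz, hUV⟩)))
  · ext U V
    constructor
    · intro h
      -- Since `r` is additive, the open sets related to `V` form a directed cover of `f ⁻¹' V`.
      obtain ⟨W, hWV, hUW⟩ : ∃ W, r W V ∧ closure (U : Set X) ⊆ W := by
        refine U.isCompact_closure.induction_on (p := fun K => ∃ W, r W V ∧ K ⊆ W)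
          ⟨⊥, hr.minimum V, Set.empty_subset _⟩
          (fun s t hst ⟨W, hW, htW⟩ => ⟨W, hW, hst.trans htW⟩) ?_ ?_
        · rintro s t ⟨W, hW, hsW⟩ ⟨W', hW', htW⟩
          exact ⟨W ⊔ W', sup_idem V ▸ hr.additivity hW hW', Set.union_subset_union hsW htW⟩
        · intro x hx
          obtain ⟨W, hxW, hW⟩ := (hf x V).2 (h hx)
          exact ⟨W, mem_nhdsWithin_of_mem_nhds (W.isOpen.mem_nhds hxW), W, hW, subset_rfl⟩
      exact hr.mono_left (RelCompactOpens.le_def.2 (subset_closure.trans hUW)) hWV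
    · intro h
      obtain ⟨W, hUW, hWV⟩ := hr.interpolation_left h
      exact fun x hx => (hf x V).1 ⟨W, hUW hx, hWV⟩

end IsInterpolator

/-! ### Every basic lattice is isomorphic to one of relatively compact open sets -/

namespace RoundPrimeFilter

variable {B : Type u} [BasicLattice B]

theorem isInterpolator_closure_basicOpen_subset :
    IsInterpolator fun (x : B) (U : RelCompactOpens (RoundPrimeFilter B)) =>
      closure (basicOpen x) ⊆ U where
  minimum U := by simp
  cofinality x := exists_closure_subset (.mk _ (isOpen_basicOpen x) (isCompact_closure_basicOpen x))
  interpolation_right {x U} h := RelCompactOpens.exists_between (isCompact_closure_basicOpen x)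
    U.isOpen h
  interpolation_left {x U} h :=
    (exists_basicOpen_between (isCompact_closure_basicOpen x) U.isOpen h).imp
      fun _ h => ⟨prec_iff_closure_subset.2 h.1, h.2⟩
  multiplicativity h h' := by
    rw [basicOpen_inf]
    exact closure_inter_subset_inter_closure _ _ |>.trans (Set.inter_subset_inter h h')
  additivity h h' := by
    rw [basicOpen_sup, closure_union]
    exact Set.union_subset_union h h'
  decomposition {x U V} h := by
    obtain ⟨K, L, hK, hL, hKU, hLV, hKL⟩ :=
      (isCompact_closure_basicOpen x).binary_compact_cover U.isOpen V.isOpen h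
    obtain ⟨u, hKu, huU⟩ := exists_basicOpen_between hK U.isOpen hKU
    obtain ⟨v, hLv, hvV⟩ := exists_basicOpen_between hL V.isOpen hLV
    have hx : x ≺ u ⊔ v := by
      rw [prec_iff_closure_subset, hKL, basicOpen_sup]
      exact Set.union_subset_union hKu hLv
    obtain ⟨x', y', hx', hy', rfl⟩ := decomposition hx
    exact ⟨x', y', (closure_mono (basicOpen_mono (le_of_prec hx'))).trans huU,
      (closure_mono (basicOpen_mono (le_of_prec hy'))).trans hvV, rfl⟩
  eq_bot {x} h := le_bot_iff.1 <| le_iff_basicOpen_subset.2 <| by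
    simpa using subset_closure.trans h

theorem isInterpolator_closure_subset_basicOpen :
    IsInterpolator fun (U : RelCompactOpens (RoundPrimeFilter B)) (x : B) =>
      closure (U : Set (RoundPrimeFilter B)) ⊆ basicOpen x where
  minimum x := by simp
  cofinality U := (exists_basicOpen_between U.isCompact_closure isOpen_univ
    (Set.subset_univ _)).imp fun _ h => h.1
  interpolation_right {U x} h :=
    (exists_basicOpen_between U.isCompact_closure (isOpen_basicOpen x) h).imp
      fun _ h => ⟨h.1, prec_iff_closure_subset.2 h.2⟩
  interpolation_left {U x} h :=
    RelCompactOpens.exists_between U.isCompact_closure (isOpen_basicOpen x) h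
  multiplicativity h h' := by
    rw [basicOpen_inf]
    exact closure_inter_subset_inter_closure _ _ |>.trans (Set.inter_subset_inter h h')
  additivity h h' := by
    rw [basicOpen_sup, coe_sup, closure_union]
    exact Set.union_subset_union h h'
  decomposition {U x y} h := exists_eq_sup_of_closure_subset_union U (isOpen_basicOpen x)
    (isOpen_basicOpen y) (basicOpen_sup x y ▸ h)
  eq_bot {U} h := SetLike.coe_injective <| by
    simpa using subset_closure.trans h

end RoundPrimeFilter

/-! ### The equivalence of categories -/

instance (X : LocHaus.{u}) : T2Space X.obj := X.property.1

instance (X : LocHaus.{u}) : LocallyCompactSpace X.obj := X.property.2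

/-- The functor taking a locally compact Hausdorff space to the basic lattice of its relatively
compact open sets. -/
def relCompactOpensFunctor : LocHaus.{u} ⥤ BasLat.{u} where
  obj X := ⟨RelCompactOpens X.obj⟩
  map f := ⟨mapRel f.hom, isInterpolator_mapRel f.hom.hom.continuous⟩
  map_id _ := rfl
  map_comp f g := BasLat.Hom.ext
    (comp_mapRel f.hom.hom.continuous g.hom.hom.continuous).symm

instance : relCompactOpensFunctor.{u}.Faithful where
  map_injective {X Y f g} h := by
    refine ObjectProperty.hom_ext _ (TopCat.hom_ext (ContinuousMap.ext fun x => ?_))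
    exact congrFun (mapRel_injective f.hom.hom.continuous (congrArg BasLat.Hom.rel h)) x

instance : relCompactOpensFunctor.{u}.Full where
  map_surjective {X Y} r := by
    obtain ⟨f, hf, hfr⟩ := r.isInterpolator.exists_continuous_mapRel_eq
    exact ⟨ObjectProperty.homMk (TopCat.ofHom ⟨f, hf⟩), BasLat.Hom.ext hfr⟩

open RoundPrimeFilter in
instance : relCompactOpensFunctor.{u}.EssSurj where
  mem_essImage B := by
    refine ⟨⟨TopCat.of (RoundPrimeFilter B.carrier), inferInstance, inferInstance⟩, ⟨
      { hom := ⟨_, isInterpolator_closure_subset_basicOpen⟩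
        inv := ⟨_, isInterpolator_closure_basicOpen_subset⟩
        hom_inv_id := BasLat.Hom.ext ?_
        inv_hom_id := BasLat.Hom.ext ?_ }⟩⟩
    · funext U V
      refine propext ⟨?_, fun h => exists_basicOpen_between U.isCompact_closure V.isOpen h⟩
      rintro ⟨x, hUx, hxV⟩
      exact hUx.trans (subset_closure.trans hxV)
    · funext x y
      refine propext ⟨?_, fun h => ?_⟩
      · rintro ⟨U, hxU, hUy⟩
        exact prec_iff_closure_subset.2 (hxU.trans (subset_closure.trans hUy))
      · exact RelCompactOpens.exists_between (isCompact_closure_basicOpen x) (isOpen_basicOpen y)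
          (prec_iff_closure_subset.1 h)

theorem mainTheorem3 : Nonempty (BasLat.{u} ≌ LocHaus.{u}) := by
  have : relCompactOpensFunctor.{u}.IsEquivalence := {}
  exact ⟨relCompactOpensFunctor.asEquivalence.symm⟩
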